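/- Let $\|\cdot\|$ be any norm on $\mathbb{R}^d$. A set $Q\subseteq\mathbb{R}^d$ is polyhedral if it is the intersection of finitely many closed half-spaces. A function $f\colon\mathbb{R}^d\to\mathbb{R}$ is piecewise affine if there are polyhedral sets $Q_1,\dots,Q_s\subseteq\mathbb{R}^d$ with $\bigcup_{i} Q_i=\mathbb{R}^d$, $\operatorname{int} Q_i\neq\emptyset$ for all $i$, and $\operatorname{int} Q_i\cap\operatorname{int} Q_j=\emptyset$ for $i\neq j$, and affine functions $F_1,\dots,F_s\colon\mathbb{R}^d\to\mathbb{R}$ such that $f(x)=F_i(x)$ for all $x\in Q_i$ and all $i$. Put $S(f)=\{x\in\mathbb{R}^d : f(x)\le 0\}$ and $\operatorname{dist}(x,S(f))=\inf_{y\in S(f)}\|x-y\|$. **Theorem.** Let $f\colon\mathbb{R}^d\to\mathbb{R}$ be piecewise affine with $S(f)\neq\emptyset$. Then $f$ has an error bound on every bounded set: for every bounded $V\subset\mathbb{R}^d$ there exists $\tau>0$ such that $$\tau\,\operatorname{dist}(x,S(f))\le\max\{f(x),0\}\qquad\text{for all }x\in V.$$ -/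

import Mathlib

/-- A set `Q ⊆ ℝ^d` is polyhedral: it is the intersection of finitely many closed half-spaces
`{x | ⟨v i, x⟩ ≤ b i}`, `v i ≠ 0`. -/
def IsPolyhedral {d : ℕ} (Q : Set (Fin d → ℝ)) : Prop :=
  ∃ (m : ℕ) (v : Fin m → Fin d → ℝ) (b : Fin m → ℝ),
    (∀ i, v i ≠ 0) ∧ Q = ⋂ i, {x | v i ⬝ᵥ x ≤ b i}

/-- A polyhedral partition of `ℝ^d`: finitely many polyhedral sets that cover the space and have
nonempty, pairwise disjoint interiors. -/
structure IsPolyhedralPartition {d s : ℕ} (Q : Fin s → Set (Fin d → ℝ)) : Prop where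
  polyhedral : ∀ i, IsPolyhedral (Q i)
  cover : ⋃ i, Q i = Set.univ
  interior_nonempty : ∀ i, (interior (Q i)).Nonempty
  interior_disjoint : ∀ i j, i ≠ j → interior (Q i) ∩ interior (Q j) = ∅

/-- `f : ℝ^d → ℝ` is piecewise affine: it coincides with an affine function on each cell of some
polyhedral partition. -/
def IsPiecewiseAffine {d : ℕ} (f : (Fin d → ℝ) → ℝ) : Prop :=
  ∃ (s : ℕ) (Q : Fin s → Set (Fin d → ℝ)) (F : Fin s → ((Fin d → ℝ) →ᵃ[ℝ] ℝ)),
    IsPolyhedralPartition Q ∧ ∀ i, ∀ x ∈ Q i, f x = F i x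

/-- The lower `0`-level set `S(f) = {x | f x ≤ 0}`. -/
def lowerZeroLevel {d : ℕ} (f : (Fin d → ℝ) → ℝ) : Set (Fin d → ℝ) := {x | f x ≤ 0}

/-- The distance `inf_{y ∈ A} N (x - y)` from `x` to a nonempty set `A`, in the norm `N`. -/
noncomputable def distTo {d : ℕ} (N : Seminorm ℝ (Fin d → ℝ)) (x : Fin d → ℝ)
    (A : Set (Fin d → ℝ)) : ℝ :=
  ⨅ y : A, N (x - y)

/-- `f` has an error bound on `V`, with distances measured in the norm `N`: there is `τ > 0` with
`τ * dist(x, S(f)) ≤ max (f x) 0` for all `x ∈ V`. -/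
def HasErrorBoundOn {d : ℕ} (N : Seminorm ℝ (Fin d → ℝ)) (f : (Fin d → ℝ) → ℝ)
    (V : Set (Fin d → ℝ)) : Prop :=
  ∃ τ : ℝ, 0 < τ ∧ ∀ x ∈ V, τ * distTo N x (lowerZeroLevel f) ≤ max (f x) 0

open Filter Topology

/-! Work cell by cell: on a polyhedral cell `f` is affine. If the cell meets `S(f)`, a Hoffman-type
bound holds on the whole cell. Otherwise `f` is positive there, hence bounded below on its bounded
part, and any fixed point of `S(f)` serves. Finitely many cells give a uniform constant, and `N` is
dominated by the sup norm. -/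

theorem Seminorm.exists_pos_le_mul_norm {d : ℕ} (N : Seminorm ℝ (Fin d → ℝ)) :
    ∃ C : ℝ, 0 < C ∧ ∀ x, N x ≤ C * ‖x‖ := by
  have h0 : 0 ≤ ∑ i, N (Pi.single i 1) := Finset.sum_nonneg fun i _ => apply_nonneg N _
  refine ⟨∑ i, N (Pi.single i 1) + 1, by linarith, fun x => ?_⟩
  have hx : x = ∑ i, x i • (Pi.single i 1 : Fin d → ℝ) := pi_eq_sum_univ' x
  have h1 : N x ≤ ∑ i, N (x i • (Pi.single i 1 : Fin d → ℝ)) := by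
    conv_lhs => rw [hx]
    exact Finset.le_sum_of_subadditive N (map_zero N).le (map_add_le_add N) _ _
  calc N x ≤ ∑ i, N (x i • (Pi.single i 1 : Fin d → ℝ)) := h1
    _ ≤ ∑ i, N (Pi.single i 1) * ‖x‖ := by
      refine Finset.sum_le_sum fun i _ => ?_
      rw [map_smul_eq_mul, mul_comm]
      exact mul_le_mul_of_nonneg_left (norm_le_pi_norm x i) (apply_nonneg N _)
    _ = (∑ i, N (Pi.single i 1)) * ‖x‖ := by rw [Finset.sum_mul]
    _ ≤ _ := by nlinarith [norm_nonneg x]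

theorem exists_pos_forall_of_finite {ι : Type*} [Finite ι] {P : ι → ℝ → Prop}
    (h : ∀ i, ∀ᶠ c in 𝓝[>] (0 : ℝ), P i c) : ∃ c : ℝ, 0 < c ∧ ∀ i, P i c :=
  ((eventually_mem_nhdsWithin (a := (0 : ℝ)) (s := Set.Ioi 0)).and (eventually_all.2 h)).exists

theorem IsPolyhedral.isClosed {d : ℕ} {Q : Set (Fin d → ℝ)} (hQ : IsPolyhedral Q) :
    IsClosed Q := by
  obtain ⟨m, v, b, -, rfl⟩ := hQ
  refine isClosed_iInter fun i => isClosed_le ?_ continuous_const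
  exact continuous_const.dotProduct continuous_id

/-- A point that minimises `max F 0 + c * dist(·, x)` over a polyhedral set satisfies `F ≤ 0`,
since otherwise one of finitely many descent directions, one for each set of active constraints,
improves it. -/
theorem IsPolyhedral.exists_pos_forall_exists_mul_norm_sub_le {d : ℕ} {Q : Set (Fin d → ℝ)}
    (hQ : IsPolyhedral Q) (F : (Fin d → ℝ) →ᵃ[ℝ] ℝ) {p : Fin d → ℝ} (hp : p ∈ Q)
    (hFp : F p ≤ 0) :
    ∃ c : ℝ, 0 < c ∧ ∀ x ∈ Q, ∃ y ∈ Q, F y ≤ 0 ∧ c * ‖x - y‖ ≤ max (F x) 0 := by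
  have hcl := hQ.isClosed
  obtain ⟨m, v, b, -, rfl⟩ := hQ
  have hFc : Continuous F := F.continuous_of_finiteDimensional
  -- Directions depend only on the active set `I`, of which there are finitely many; this makes `c`
  -- independent of `x`.
  have hdesc : ∀ I : Set (Fin m), ∃ w : Fin d → ℝ,
      (∃ w', (∀ i ∈ I, v i ⬝ᵥ w' ≤ 0) ∧ F.linear w' < 0) →
        (∀ i ∈ I, v i ⬝ᵥ w ≤ 0) ∧ F.linear w < 0 := fun I => by
    by_cases h : ∃ w', (∀ i ∈ I, v i ⬝ᵥ w' ≤ 0) ∧ F.linear w' < 0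
    · exact ⟨h.choose, fun _ => h.choose_spec⟩
    · exact ⟨0, fun h' => absurd h' h⟩
  choose w hw using hdesc
  obtain ⟨c, hc, hcw⟩ := exists_pos_forall_of_finite
    (P := fun (I : Set (Fin m)) c => F.linear (w I) < 0 → F.linear (w I) + c * ‖w I‖ < 0)
    (fun I => by
      by_cases h : F.linear (w I) < 0
      · have ht : Tendsto (fun c : ℝ => F.linear (w I) + c * ‖w I‖) (𝓝[>] 0)
            (𝓝 (F.linear (w I) + 0 * ‖w I‖)) :=
          (Continuous.tendsto (by fun_prop) 0).mono_left nhdsWithin_le_nhds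
        rw [zero_mul, add_zero] at ht
        filter_upwards [ht.eventually_lt_const h] with c hc _ using hc
      · exact Eventually.of_forall fun c h' => absurd h' h)
  refine ⟨c, hc, fun x hx => ?_⟩
  set G : (Fin d → ℝ) → ℝ := fun y => max (F y) 0 + c * ‖x - y‖ with hG
  have hGc : Continuous G := by fun_prop
  -- Outside this ball the penalty `c * ‖x - y‖` alone exceeds `G x`, so the minimum is global on
  -- the polyhedron.
  obtain ⟨y, ⟨hyQ, -⟩, hmin⟩ :=
    ((isCompact_closedBall x (max (F x) 0 / c)).inter_left hcl).exists_isMinOn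
      ⟨x, hx, Metric.mem_closedBall_self (div_nonneg (le_max_right _ _) hc.le)⟩ hGc.continuousOn
  have hGx : G x = max (F x) 0 := by simp [hG]
  have hyx : G y ≤ G x :=
    hmin ⟨hx, Metric.mem_closedBall_self (div_nonneg (le_max_right _ _) hc.le)⟩
  have hglob : ∀ z ∈ ⋂ i, {x | v i ⬝ᵥ x ≤ b i}, G y ≤ G z := fun z hz => by
    by_cases hzb : z ∈ Metric.closedBall x (max (F x) 0 / c)
    · exact hmin ⟨hz, hzb⟩
    · rw [Metric.mem_closedBall, not_le, dist_comm, dist_eq_norm, div_lt_iff₀ hc] at hzb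
      have := le_max_right (F z) 0
      simp only [hG] at hyx hGx ⊢
      linarith
  have hbound : c * ‖x - y‖ ≤ max (F x) 0 := by
    have := le_max_right (F y) 0
    simp only [hG] at hyx hGx
    linarith
  refine ⟨y, hyQ, ?_, hbound⟩
  by_contra! hFy
  simp only [Set.mem_iInter, Set.mem_ofPred_eq] at hyQ hp hglob
  set I : Set (Fin m) := {i | v i ⬝ᵥ y = b i}
  -- Moving towards `p` keeps the active constraints and lowers `F`, as `F p ≤ 0 < F y`.
  obtain ⟨hwI, hwF⟩ := hw I ⟨p - y, fun i hi => by
      rw [dotProduct_sub, show v i ⬝ᵥ y = b i from hi]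
      linarith [hp i], by
      have := F.linearMap_vsub p y
      simp only [vsub_eq_sub] at this
      rw [this]
      linarith⟩
  have hneg := hcw I hwF
  have hFt : ∀ t : ℝ, F (y + t • w I) = F y + t * F.linear (w I) := fun t => by
    have := F.map_vadd y (t • w I)
    simp only [vadd_eq_add, map_smul, smul_eq_mul] at this
    rw [add_comm, this, add_comm]
  have hfeas : ∀ᶠ t in 𝓝[>] (0 : ℝ), ∀ i, v i ⬝ᵥ (y + t • w I) ≤ b i := by
    refine eventually_all.2 fun i => ?_
    rcases (hyQ i).eq_or_lt with hi | hi
    · filter_upwards [self_mem_nhdsWithin] with t ht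
      rw [dotProduct_add, dotProduct_smul, hi, smul_eq_mul]
      nlinarith [hwI i hi, Set.mem_Ioi.1 ht]
    · have ht : Tendsto (fun t : ℝ => v i ⬝ᵥ y + t * (v i ⬝ᵥ w I)) (𝓝[>] 0)
          (𝓝 (v i ⬝ᵥ y + 0 * (v i ⬝ᵥ w I))) :=
        (Continuous.tendsto (by fun_prop) 0).mono_left nhdsWithin_le_nhds
      rw [zero_mul, add_zero] at ht
      filter_upwards [ht.eventually_lt_const hi] with t ht
      rw [dotProduct_add, dotProduct_smul, smul_eq_mul]
      exact ht.le
  have hpos : ∀ᶠ t in 𝓝[>] (0 : ℝ), 0 < F y + t * F.linear (w I) := by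
    have ht : Tendsto (fun t : ℝ => F y + t * F.linear (w I)) (𝓝[>] 0)
        (𝓝 (F y + 0 * F.linear (w I))) :=
      (Continuous.tendsto (by fun_prop) 0).mono_left nhdsWithin_le_nhds
    rw [zero_mul, add_zero] at ht
    exact ht.eventually_const_lt hFy
  obtain ⟨t, ⟨ht1, ht2⟩, ht⟩ := ((hfeas.and hpos).and self_mem_nhdsWithin).exists
  have ht : 0 < t := ht
  have h1 := hglob _ ht1
  simp only [hG] at h1
  rw [hFt, max_eq_left hFy.le, max_eq_left ht2.le] at h1
  have h2 : ‖x - (y + t • w I)‖ ≤ ‖x - y‖ + t * ‖w I‖ := by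
    rw [← sub_sub]
    refine (norm_sub_le _ _).trans_eq ?_
    rw [norm_smul, Real.norm_of_nonneg ht.le]
  nlinarith [mul_le_mul_of_nonneg_left h2 hc.le, mul_neg_of_pos_of_neg ht hneg]

theorem IsPolyhedral.exists_pos_forall_inter_exists_mul_norm_sub_le {d : ℕ}
    {Q S V : Set (Fin d → ℝ)} (hQ : IsPolyhedral Q) (F : (Fin d → ℝ) →ᵃ[ℝ] ℝ)
    (hS : S.Nonempty) (hQS : ∀ x ∈ Q, F x ≤ 0 → x ∈ S) (hV : Bornology.IsBounded V) :
    ∃ c : ℝ, 0 < c ∧ ∀ x ∈ Q ∩ V, ∃ y ∈ S, c * ‖x - y‖ ≤ max (F x) 0 := by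
  by_cases hP : ∃ p ∈ Q, F p ≤ 0
  · obtain ⟨p, hp, hFp⟩ := hP
    obtain ⟨c, hc, h⟩ := hQ.exists_pos_forall_exists_mul_norm_sub_le F hp hFp
    refine ⟨c, hc, fun x hx => ?_⟩
    obtain ⟨y, hy, hFy, hxy⟩ := h x hx.1
    exact ⟨y, hQS y hy hFy, hxy⟩
  -- Only this case needs `V` bounded: `F` may tend to `0` relative to distance at infinity.
  push Not at hP
  obtain ⟨s, hs⟩ := hS
  obtain ⟨R, hR, hVR⟩ := hV.subset_closedBall_lt 0 s
  obtain ⟨δ, hδ, hFδ⟩ : ∃ δ : ℝ, 0 < δ ∧ ∀ x ∈ Q ∩ Metric.closedBall s R, δ ≤ F x := by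
    rcases (Q ∩ Metric.closedBall s R).eq_empty_or_nonempty with he | hne
    · exact ⟨1, one_pos, by simp [he]⟩
    · obtain ⟨z, hz, hmin⟩ := ((isCompact_closedBall s R).inter_left hQ.isClosed).exists_isMinOn
        hne F.continuous_of_finiteDimensional.continuousOn
      exact ⟨F z, hP z hz.1, fun x hx => hmin hx⟩
  refine ⟨δ / R, div_pos hδ hR, fun x hx => ⟨s, hs, ?_⟩⟩
  have hxR := hVR hx.2
  calc δ / R * ‖x - s‖ ≤ δ / R * R := by
        gcongr
        rwa [← dist_eq_norm]
    _ = δ := div_mul_cancel₀ _ hR.ne'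
    _ ≤ F x := hFδ x ⟨hx.1, hxR⟩
    _ ≤ max (F x) 0 := le_max_left _ _

theorem distTo_le {d : ℕ} (N : Seminorm ℝ (Fin d → ℝ)) (x : Fin d → ℝ) {y : Fin d → ℝ}
    {A : Set (Fin d → ℝ)} (hy : y ∈ A) : distTo N x A ≤ N (x - y) :=
  ciInf_le (f := fun y : A => N (x - y)) ⟨0, by rintro _ ⟨z, rfl⟩; exact apply_nonneg N _⟩ ⟨y, hy⟩

theorem mainTheorem4 {d : ℕ} (N : Seminorm ℝ (Fin d → ℝ)) (hN : ∀ x, N x = 0 → x = 0)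
    (f : (Fin d → ℝ) → ℝ) (hf : IsPiecewiseAffine f) (hS : (lowerZeroLevel f).Nonempty)
    (V : Set (Fin d → ℝ)) (hV : Bornology.IsBounded V) :
    HasErrorBoundOn N f V := by
  obtain ⟨s, Q, F, hQ, hfF⟩ := hf
  obtain ⟨C, hC, hNC⟩ := N.exists_pos_le_mul_norm
  choose c hc h using fun i =>
    (hQ.polyhedral i).exists_pos_forall_inter_exists_mul_norm_sub_le (F i) hS
      (fun x hx hFx => show f x ≤ 0 from (hfF i x hx).trans_le hFx) hV
  obtain ⟨κ, hκ, hκc⟩ := exists_pos_forall_of_finite (P := fun i κ => κ < c i)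
    fun i => (eventually_lt_nhds (hc i)).filter_mono nhdsWithin_le_nhds
  refine ⟨κ / C, div_pos hκ hC, fun x hx => ?_⟩
  obtain ⟨i, hi⟩ := Set.mem_iUnion.1 (hQ.cover.symm ▸ Set.mem_univ x : x ∈ ⋃ i, Q i)
  obtain ⟨y, hy, hxy⟩ := h i x ⟨hi, hx⟩
  rw [hfF i x hi]
  calc κ / C * distTo N x (lowerZeroLevel f) ≤ κ / C * (C * ‖x - y‖) := by
        gcongr
        exact (distTo_le N x hy).trans (hNC _)
    _ = κ * ‖x - y‖ := by field_simp
    _ ≤ c i * ‖x - y‖ := by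
        gcongr
        exact (hκc i).le
    _ ≤ _ := hxy
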